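/- **Setting.** Let $G=(V,E)$ be a finite connected simple graph with edge weights $w:E\to(0,1]$, and let $d(u,v)$ be the least total weight of a path from $u$ to $v$. A set $C\subseteq V$ is a *cluster* if $|C|>2$ and, for every partition $C=C_1\sqcup C_2$ into nonempty parts, $\operatorname{argmin}_{z\in V\setminus C_1}\min_{v\in C_1}d(z,v)\subseteq C_2$. For a finite nonempty edge set $F$ with real weights $w$ and an edge $e$, we say that $H_F(e)$ holds (for $w$) if $\alpha\max_F w<w(e)$, where $\alpha=\max_F w/\min_F w\ge 1$. For a tree $T$ and $C\subseteq V$, $T_{|C}$ denotes the set of edges of $T$ with both endpoints in $C$. Let $C_1,\dots,C_K$ be pairwise disjoint clusters, all *strongly homogeneous*: for every $i$, every spanning tree $T$ of $G$ such that $T_{|C_i}$ has an edge, and every edge $e$ of $T$ joining $C_i$ to some $C_j$, $j\ne i$, the condition $H_{T_{|C_i}}(e)$ holds. **Mechanisms.** $w,w'$ are neighbouring if $|w(e)-w'(e)|\le\mu$ for all $e\in E$ ($\mu>0$). PAMST with parameter $\epsilon>0$ starts from a uniformly random vertex and, as long as the set $S$ of visited vertices is not $V$, draws an edge $r$ in the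 set $R$ of edges with exactly one endpoint in $S$, with probability proportional to $\exp\big(\epsilon' u(w,r)/(2\Delta u)\big)$, where $\epsilon'=\epsilon/(|V|-1)$, $u(w,r)=-|w(r)-\min_{R}w|$ and $\Delta u$ is the maximum of $|u(w_1,r)-u(w_2,r)|$ over $r\in R$ and neighbouring $w_1,w_2$; the edge $r$ and its new endpoint are then added. The output $T$ is the set of drawn edges. $\mathrm{Lap}(\theta,b)$ has density $\frac1{2b}e^{-|x-\theta|/b}$. For $s>0$, $\tau\ge0$, $p\ge1$, the Weight-Release mechanism replaces the weights on $T$ by $w'(e)=(w(e)+Y_e+\tau)/p$, with $Y_e$ i.i.d. $\mathrm{Lap}(0,s)$. **Theorem.** There is $s_0>0$, depending only on $G$, $w$ and the clusters, such that the following holds for all $\mu,\epsilon>0$, every possible output $T$ of PAMST (i.e. every $T$ of positive probability), all $i\ne j$, every edge $e$ of $T$ joining $C_i$ and $C_j$ for which $H_{T_{|C_i}}(e)$ holds for $w$, both choices $F=T$ and $F=T_{|C_i}$, and all $s>0$, $\tau\ge 0$, $p\ge 1$. Put $n=|C_i|-1$, $\delta=s/p$, $\theta_{\max}=(\max_F w+\tau)/p$,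 $\theta_{\min}=(\min_F w+\tau)/p$, $\theta=(w(e)+\tau)/p$, and $$\varphi=\big(\max_{k\le n}Y_k\big)^2-\big(\min_{k\le n}Z_k\big)X^{out},$$ with independent $Y_1,\dots,Y_n\sim\mathrm{Lap}(\theta_{\max},\delta)$, $Z_1,\dots,Z_n\sim\mathrm{Lap}(\theta_{\min},\delta)$, $X^{out}\sim\mathrm{Lap}(\theta,\delta)$. Then: 1. $\varphi$ is square integrable, and $\mathbb E(\varphi)=\Lambda_3-\theta\Lambda_4$, $\ \mathbb V(\varphi)=\Lambda_1+(\theta^2+2\delta^2)\Lambda_2-(\Lambda_3^2+\theta^2\Lambda_4^2)$, where $$\alpha(r,k)=(-1)^k\sum_{j=0}^{n-r}\frac{(-1)^j\binom{n-r}{j}}{2^{r+j}(r+j)^{k+1}}+\sum_{j=0}^{r-1}\frac{(-1)^j\binom{r-1}{j}}{2^{n-r+1+j}(n-r+1+j)^{k+1}},$$ $$\Lambda_1=24\delta^4n\,\alpha(n,4)+24\theta_{\max}\delta^3n\,\alpha(n,3)+12\theta_{\max}^2\delta^2n\,\alpha(n,2)+4\theta_{\max}^3\delta n\,\alpha(n,1)+\theta_{\max}^4,$$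 $$\Lambda_2=2\delta^2n\,\alpha(1,2)+2\theta_{\min}\delta n\,\alpha(1,1)+\theta_{\min}^2,\quad \Lambda_3=2\delta^2n\,\alpha(n,2)+2\theta_{\max}\delta n\,\alpha(n,1)+\theta_{\max}^2,\quad \Lambda_4=\delta n\,\alpha(1,1)+\theta_{\min}.$$ 2. If $s\le s_0$, then $H_{T_{|C_i}}(e)$ holds for the released weights $w'$ with probability (over the noise of the Weight-Release mechanism) at least $$1-\frac{\mathbb V(\varphi)}{\mathbb V(\varphi)+\mathbb E(\varphi)^2}.$$ -/

import Mathlib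

open MeasureTheory ProbabilityTheory
open scoped ENNReal

namespace PTClust

noncomputable section

/-! ### Weighted graphs, clusters, spanning trees

A weighted graph is a simple graph `G` on `V` together with `w : Sym2 V → ℝ`, of which only the
values on edges matter. A tree topology on `V` is given by its finite set `T` of edges. -/

/-- Minimum path distance: the least total weight of a path from `u` to `v`. -/
def pathDist {V : Type*} (G : SimpleGraph V) (w : Sym2 V → ℝ) (u v : V) : ℝ :=
  ⨅ q : G.Path u v, ((q : G.Walk u v).edges.map w).sum

/-- The distance `min_{v ∈ A} d(z, v)` from `z` to a nonempty finite set of vertices. -/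
def distTo {V : Type*} (G : SimpleGraph V) (w : Sym2 V → ℝ) (A : Finset V) (hA : A.Nonempty)
    (z : V) : ℝ :=
  A.inf' hA (fun v => pathDist G w z v)

open scoped Classical in
/-- `A` is a cluster of the weighted graph `(G, w)`: it has more than two elements and, whenever
`A` is split into two nonempty parts `A₁` and `A₂`, all points outside `A₁` which are closest to
`A₁` belong to `A₂`. -/
def IsCluster {V : Type*} (G : SimpleGraph V) (w : Sym2 V → ℝ) (A : Finset V) : Prop :=
  2 < A.card ∧
    ∀ (A₁ A₂ : Finset V) (h₁ : A₁.Nonempty), A₂.Nonempty → A = A₁ ∪ A₂ → A₁ ∩ A₂ = ∅ →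
      {z | z ∉ A₁ ∧ ∀ z' ∉ A₁, distTo G w A₁ h₁ z ≤ distTo G w A₁ h₁ z'} ⊆ (A₂ : Set V)

/-- `T` is the edge set of a spanning tree of `G`. -/
def IsSpanningTree {V : Type*} (G : SimpleGraph V) (T : Finset (Sym2 V)) : Prop :=
  (T : Set (Sym2 V)) ⊆ G.edgeSet ∧ (SimpleGraph.fromEdgeSet (T : Set (Sym2 V))).IsTree

/-- `e` joins a vertex of `A` and a vertex of `B`. -/
def Joins {V : Type*} (e : Sym2 V) (A B : Finset V) : Prop :=
  ∃ k ∈ A, ∃ l ∈ B, e = s(k, l)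

open scoped Classical in
/-- The edges of the restriction of `T` to the vertex set `A`. -/
def edgesWithin {V : Type*} (T : Finset (Sym2 V)) (A : Finset V) : Finset T :=
  Finset.univ.filter (fun e => ∀ v ∈ (e : Sym2 V), v ∈ A)

/-- Homogeneous separability by `e` of the tree with edge set `F`, for edge weights `w`:
`α · max_F w < w e` where `α = max_F w / min_F w ≥ 1`. (`F` has to be nonempty for the maximum and
the minimum to make sense.) -/
def HomSep {ι : Type*} (w : ι → ℝ) (F : Finset ι) (e : ι) : Prop :=
  ∃ hF : F.Nonempty,
    1 ≤ F.sup' hF w / F.inf' hF w ∧ F.sup' hF w / F.inf' hF w * F.sup' hF w < w e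

/-- The restriction of the weight function to the edges of `T`. -/
def treeWeight {V : Type*} (w : Sym2 V → ℝ) (T : Finset (Sym2 V)) : T → ℝ :=
  fun e => w e

/-- The cluster `C i` is strongly homogeneous: for every spanning tree `T` of `G` and every edge
`e` of `T` which joins `C i` to another cluster, the restriction of `T` to `C i` is homogeneously
separable by `e` (trees without an edge inside `C i` impose no condition). -/
def StronglyHomogeneous {V : Type*} (G : SimpleGraph V) (w : Sym2 V → ℝ) {K : ℕ}
    (C : Fin K → Finset V) (i : Fin K) : Prop :=
  ∀ T : Finset (Sym2 V), IsSpanningTree G T → ∀ j ≠ i, ∀ e : T, Joins (e : Sym2 V) (C i) (C j) →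
    (edgesWithin T (C i)).Nonempty → HomSep (treeWeight w T) (edgesWithin T (C i)) e

/-! ### The exponential mechanism and PAMST -/

/-- Neighbouring weight functions on the edge set of `G`. -/
def Neighboring {V : Type*} (G : SimpleGraph V) (μ : ℝ) (w w' : Sym2 V → ℝ) : Prop :=
  ∀ e ∈ G.edgeSet, |w e - w' e| ≤ μ

/-- The utility `u(w, r) = -|w r - min_{r' ∈ R} w r'|`. -/
def utility {V : Type*} (R : Finset (Sym2 V)) (hR : R.Nonempty) (w : Sym2 V → ℝ)
    (r : Sym2 V) : ℝ :=
  -|w r - R.inf' hR w|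

/-- The sensitivity of the utility function on the range `R`. -/
def sensitivity {V : Type*} (G : SimpleGraph V) (μ : ℝ) (R : Finset (Sym2 V))
    (hR : R.Nonempty) : ℝ :=
  sSup {x | ∃ r ∈ R, ∃ w w', Neighboring G μ w w' ∧ x = |utility R hR w r - utility R hR w' r|}

open scoped Classical in
/-- The weight `exp (ε u(r) / (2 Δ))` on the range `R`. -/
def expWeight {α : Type*} (u : α → ℝ) (Δ ε : ℝ) (R : Finset α) (r : α) : ℝ≥0∞ :=
  if r ∈ R then ENNReal.ofReal (Real.exp (ε * u r / (2 * Δ))) else 0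

theorem expWeight_tsum_ne_zero {α : Type*} (u : α → ℝ) (Δ ε : ℝ) (R : Finset α)
    (hR : R.Nonempty) : ∑' r, expWeight u Δ ε R r ≠ 0 := by
  obtain ⟨r, hr⟩ := hR
  intro h
  have h2 := ENNReal.tsum_eq_zero.1 h r
  rw [expWeight, if_pos hr, ENNReal.ofReal_eq_zero] at h2
  exact absurd h2 (not_le.2 (Real.exp_pos _))

theorem expWeight_tsum_ne_top {α : Type*} (u : α → ℝ) (Δ ε : ℝ) (R : Finset α) :
    ∑' r, expWeight u Δ ε R r ≠ ∞ := by
  rw [tsum_eq_sum (s := R) (fun r hr => by simp [expWeight, hr])]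
  exact ENNReal.sum_ne_top.2 fun r hr => by simp [expWeight, hr]

/-- The exponential mechanism: `r ∈ R` has probability proportional to `exp (ε u(r) / (2 Δ))`. -/
def expMech {α : Type*} (u : α → ℝ) (Δ ε : ℝ) (R : Finset α) (hR : R.Nonempty) : PMF α :=
  PMF.normalize (expWeight u Δ ε R) (expWeight_tsum_ne_zero u Δ ε R hR)
    (expWeight_tsum_ne_top u Δ ε R)

open scoped Classical in
/-- The edges of `G` with exactly one endpoint in `S`. -/
def boundaryEdges {V : Type*} [Fintype V] (G : SimpleGraph V) (S : Finset V) :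
    Finset (Sym2 V) :=
  Finset.univ.filter (fun e => e ∈ G.edgeSet ∧ ∃ u ∈ S, ∃ v, v ∉ S ∧ e = s(u, v))

open scoped Classical in
/-- One iteration of PAMST, on pairs (visited vertices, chosen edges): an edge `r` that leaves the
set of visited vertices is drawn by the exponential mechanism with privacy parameter
`ε / (|V| - 1)`; `r` and its new endpoint are recorded. -/
def pamstStep {V : Type*} [Fintype V] (G : SimpleGraph V) (μ : ℝ) (w : Sym2 V → ℝ) (ε : ℝ)
    (st : Finset V × Finset (Sym2 V)) : PMF (Finset V × Finset (Sym2 V)) :=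
  if hR : (boundaryEdges G st.1).Nonempty then
    (expMech (utility (boundaryEdges G st.1) hR w) (sensitivity G μ (boundaryEdges G st.1) hR)
      (ε / ((Fintype.card V : ℝ) - 1)) (boundaryEdges G st.1) hR).map
        (fun r => (st.1 ∪ Finset.univ.filter (fun v => v ∈ r), insert r st.2))
  else PMF.pure st

/-- The law of the tree topology returned by PAMST: start at a random vertex and iterate
`pamstStep` until all vertices are visited. Each step visits one new vertex of the connected
graph `G`, so the loop makes `|V| - 1` iterations. -/
def pamst {V : Type*} [Fintype V] [Nonempty V] (G : SimpleGraph V) (μ : ℝ) (w : Sym2 V → ℝ)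
    (ε : ℝ) : PMF (Finset (Sym2 V)) :=
  (PMF.uniformOfFintype V).bind fun v =>
    (((fun d : PMF (Finset V × Finset (Sym2 V)) => d.bind (pamstStep G μ w ε))^[Fintype.card V - 1])
      (PMF.pure ({v}, ∅))).map Prod.snd

/-! ### Laplace noise and the Weight-Release mechanism -/

/-- The Laplace distribution with location `θ` and scale `b > 0`. -/
def laplace (θ b : ℝ) : Measure ℝ :=
  volume.withDensity fun x => ENNReal.ofReal (1 / (2 * b) * Real.exp (-(|x - θ| / b)))

/-- The law of the released weights `(w + Y + τ) / p`, with i.i.d. noise `Y e ∼ Lap(0, s)`. -/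
def weightRelease {E : Type*} [Fintype E] (w : E → ℝ) (s τ p : ℝ) : Measure (E → ℝ) :=
  (Measure.pi fun _ : E => laplace 0 s).map fun Y e => (w e + Y e + τ) / p

/-- The joint law of the independent family `(Y_1, …, Y_n), (Z_1, …, Z_n), X` with
`Y_j ∼ Lap(θmax, δ)`, `Z_j ∼ Lap(θmin, δ)`, `X ∼ Lap(θout, δ)`. -/
def noiseLaw (n : ℕ) (θmax θmin θout δ : ℝ) : Measure (((Fin n → ℝ) × (Fin n → ℝ)) × ℝ) :=
  ((Measure.pi fun _ : Fin n => laplace θmax δ).prod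
    (Measure.pi fun _ : Fin n => laplace θmin δ)).prod (laplace θout δ)

/-- `φ = (max_j Y_j)² - (min_j Z_j) · X`. -/
def phi (n : ℕ) (ω : ((Fin n → ℝ) × (Fin n → ℝ)) × ℝ) : ℝ :=
  (⨆ j, ω.1.1 j) ^ 2 - (⨅ j, ω.1.2 j) * ω.2

/-! ### Moments of Laplace order statistics -/

/-- The bracket `α(r, k)` in the formula
`E[(X_{r:n} - θ)^k] = δ^k · n! k! / ((r-1)! (n-r)!) · α(r, k)` for the `k`-th moment of the `r`-th
order statistic of `n` independent `Lap(θ, δ)` variables (`1 ≤ r ≤ n`). -/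
def alpha (n r k : ℕ) : ℝ :=
  (-1) ^ k * ∑ j ∈ Finset.range (n - r + 1),
      (-1) ^ j * ((n - r).choose j : ℝ) / (2 ^ (r + j) * (r + j : ℝ) ^ (k + 1)) +
    ∑ j ∈ Finset.range r,
      (-1) ^ j * ((r - 1).choose j : ℝ) / (2 ^ (n - r + 1 + j) * ((n - r + 1 + j : ℕ) : ℝ) ^ (k + 1))

/-- `E[(max Y)^4]`. -/
def Lam1 (n : ℕ) (θmax δ : ℝ) : ℝ :=
  24 * δ ^ 4 * n * alpha n n 4 + 24 * θmax * δ ^ 3 * n * alpha n n 3 +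
    12 * θmax ^ 2 * δ ^ 2 * n * alpha n n 2 + 4 * θmax ^ 3 * δ * n * alpha n n 1 + θmax ^ 4

/-- `E[(min Z)^2]`. -/
def Lam2 (n : ℕ) (θmin δ : ℝ) : ℝ :=
  2 * δ ^ 2 * n * alpha n 1 2 + 2 * θmin * δ * n * alpha n 1 1 + θmin ^ 2

/-- `E[(max Y)^2]`. -/
def Lam3 (n : ℕ) (θmax δ : ℝ) : ℝ :=
  2 * δ ^ 2 * n * alpha n n 2 + 2 * θmax * δ * n * alpha n n 1 + θmax ^ 2

/-- `E[min Z]`. -/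
def Lam4 (n : ℕ) (θmin δ : ℝ) : ℝ :=
  δ * n * alpha n 1 1 + θmin

end

end PTClust

namespace PTClust

open Set Filter Topology

/-! ### Integrals on the half line and on the line -/

/-! Moments. Affine maps reduce everything to standard Laplace variables with distribution function
`F` and density `f`. Their maximum has density `n F^(n-1) f`. On each half line this is a
combination of exponentials, so its moments are sums of terms `k!/a^(k+1)`: this is `alpha n n k`.
The symmetry of the law turns minima into maxima, the binomial formula restores location and scale,
and independence gives the first two moments of `φ = A - B X`; see `phi_moments`.

Probability bound. No tail inequality for `φ` is used; two rates as `s → 0` are compared. With `M`,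
`m` the extreme weights inside the cluster, homogeneous separability says `M² < m · w e`, an open
condition. It survives all noise of size at most some `η`, for every shift `τ ≥ 0` and scale `p > 0`
(`HomSep.exists_stable`), so it fails with probability at most `|T| exp(-η/s)`. On the other side,
the fluctuation of `X` alone makes the variance of `φ` at least of order `s² (1+τ)²`, while its mean
is `O(1+τ)`. After `p` cancels by homogeneity, `V/(V+E²) ≥ c s²` uniformly in `τ` and `p`
(`exists_mul_sq_le_phiVar_div`). The exponential is eventually below `c s²`.

There are finitely many trees, clusters, edges and sets `F`, so one threshold serves all. PAMST
enters through the fact that its outputs consist of edges of `G`, whose weights are positive. -/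

lemma integrableOn_pow_mul_exp_neg_mul_Ioi {a : ℝ} (ha : 0 < a) (k : ℕ) :
    IntegrableOn (fun x : ℝ => x ^ k * Real.exp (-(a * x))) (Ioi 0) := by
  refine (integrableOn_rpow_mul_exp_neg_mul_rpow (s := k) (p := 1) (b := a)
    (by have : (0 : ℝ) ≤ k := k.cast_nonneg
        linarith) one_pos ha).congr_fun (fun x _ => ?_) measurableSet_Ioi
  simp

lemma integral_pow_mul_exp_neg_mul_Ioi {a : ℝ} (ha : 0 < a) (k : ℕ) :
    ∫ x in Ioi (0 : ℝ), x ^ k * Real.exp (-(a * x)) = k.factorial / a ^ (k + 1) := by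
  have h := Real.integral_rpow_mul_exp_neg_mul_Ioi (a := k + 1) (by positivity) ha
  rw [Real.Gamma_nat_eq_factorial, show ((k : ℝ) + 1) = ((k + 1 : ℕ) : ℝ) by push_cast; ring,
    Real.rpow_natCast] at h
  rw [one_div, inv_pow, mul_comm, ← div_eq_mul_inv] at h
  rw [← h]
  refine setIntegral_congr_fun measurableSet_Ioi fun x _ => ?_
  simp

lemma integrableOn_Iic_zero_of_comp_neg {f : ℝ → ℝ}
    (h : IntegrableOn (fun x => f (-x)) (Ioi 0)) : IntegrableOn f (Iic 0) := by
  have h' := ((Measure.measurePreserving_neg (volume : Measure ℝ)).integrableOn_comp_preimage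
    (f := f) (s := Iio 0) (Homeomorph.neg ℝ).measurableEmbedding).1
      (by simpa [Function.comp_def] using h)
  exact (integrableOn_Iic_iff_integrableOn_Iio (by simp)).2 h'

lemma integrable_of_halves {f : ℝ → ℝ} (h₁ : IntegrableOn (fun x => f (-x)) (Ioi 0))
    (h₂ : IntegrableOn f (Ioi 0)) : Integrable f := by
  rw [← integrableOn_univ, ← Iic_union_Ioi (a := (0 : ℝ))]
  exact (integrableOn_Iic_zero_of_comp_neg h₁).union h₂

lemma integral_eq_add_halves {f : ℝ → ℝ} (h₁ : IntegrableOn (fun x => f (-x)) (Ioi 0))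
    (h₂ : IntegrableOn f (Ioi 0)) :
    ∫ x, f x = (∫ x in Ioi (0 : ℝ), f (-x)) + ∫ x in Ioi (0 : ℝ), f x := by
  rw [← setIntegral_univ, ← Iic_union_Ioi (a := (0 : ℝ)),
    setIntegral_union (Iic_disjoint_Ioi le_rfl) measurableSet_Ioi
      (integrableOn_Iic_zero_of_comp_neg h₁) h₂, integral_comp_neg_Ioi, neg_zero]

/-! ### The standard Laplace distribution -/

/-- The density of the standard Laplace distribution. -/
noncomputable def lapDensity (x : ℝ) : ℝ := Real.exp (-|x|) / 2

/-- The distribution function of the standard Laplace distribution. -/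
noncomputable def lapCDF (x : ℝ) : ℝ :=
  if x ≤ 0 then Real.exp x / 2 else 1 - Real.exp (-x) / 2

lemma lapDensity_nonneg (x : ℝ) : 0 ≤ lapDensity x := by unfold lapDensity; positivity

lemma continuous_lapDensity : Continuous lapDensity := by unfold lapDensity; fun_prop

lemma lapDensity_of_pos {x : ℝ} (hx : 0 < x) : lapDensity x = Real.exp (-x) / 2 := by
  rw [lapDensity, abs_of_pos hx]

lemma lapDensity_neg (x : ℝ) : lapDensity (-x) = lapDensity x := by
  simp [lapDensity]

lemma lapCDF_of_pos {x : ℝ} (hx : 0 < x) : lapCDF x = 1 - Real.exp (-x) / 2 := by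
  rw [lapCDF, if_neg hx.not_ge]

lemma lapCDF_neg_of_pos {x : ℝ} (hx : 0 < x) : lapCDF (-x) = Real.exp (-x) / 2 := by
  rw [lapCDF, if_pos (by linarith)]

lemma lapCDF_nonneg (x : ℝ) : 0 ≤ lapCDF x := by
  unfold lapCDF
  split_ifs with h
  · positivity
  · have : Real.exp (-x) ≤ 1 := Real.exp_le_one_iff.2 (by linarith)
    linarith

lemma lapCDF_le_one (x : ℝ) : lapCDF x ≤ 1 := by
  unfold lapCDF
  split_ifs with h
  · have : Real.exp x ≤ 1 := Real.exp_le_one_iff.2 h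
    linarith
  · have := Real.exp_pos (-x)
    linarith

/-- The two branches have the same one-sided derivative `1/2` at `0`, so the fundamental theorem of
calculus applies on the whole line with no exceptional point. -/
lemma hasDerivAt_lapCDF (x : ℝ) : HasDerivAt lapCDF (lapDensity x) x := by
  have h1 : ∀ y : ℝ, HasDerivAt (fun x => Real.exp x / 2) (Real.exp y / 2) y := fun y =>
    (Real.hasDerivAt_exp y).div_const 2
  have h2 : ∀ y : ℝ, HasDerivAt (fun x => 1 - Real.exp (-x) / 2) (Real.exp (-y) / 2) y := fun y => by
    have := (((hasDerivAt_neg y).exp).div_const 2).const_sub 1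
    exact this.congr_deriv (by ring)
  rcases lt_trichotomy x 0 with h | rfl | h
  · rw [lapDensity, abs_of_neg h, neg_neg]
    refine (h1 x).congr_of_eventuallyEq ?_
    filter_upwards [Iio_mem_nhds h] with y hy
    rw [lapCDF, if_pos (le_of_lt hy)]
  · have e : lapDensity 0 = 1 / 2 := by simp [lapDensity]
    rw [e, ← hasDerivWithinAt_univ, ← Iic_union_Ici (a := (0 : ℝ))]
    refine HasDerivWithinAt.union ?_ ?_
    · refine HasDerivWithinAt.congr (f := fun x => Real.exp x / 2) ?_ ?_ ?_
      · simpa using (h1 0).hasDerivWithinAt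
      · intro y hy
        rw [lapCDF, if_pos (mem_Iic.1 hy)]
      · simp [lapCDF]
    · refine HasDerivWithinAt.congr (f := fun x => 1 - Real.exp (-x) / 2) ?_ ?_ ?_
      · simpa using (h2 0).hasDerivWithinAt
      · intro y hy
        rcases (mem_Ici.1 hy).eq_or_lt with rfl | hy
        · simp [lapCDF]; norm_num
        · exact lapCDF_of_pos hy
      · simp [lapCDF]; norm_num
  · rw [lapDensity_of_pos h]
    refine (h2 x).congr_of_eventuallyEq ?_
    filter_upwards [Ioi_mem_nhds h] with y hy
    exact lapCDF_of_pos hy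

lemma tendsto_lapCDF_atBot : Tendsto lapCDF atBot (𝓝 0) := by
  have h : Tendsto (fun x => Real.exp x / 2) atBot (𝓝 0) := by
    simpa using Real.tendsto_exp_atBot.div_const 2
  refine h.congr' ?_
  filter_upwards [Iic_mem_atBot 0] with x hx
  rw [lapCDF, if_pos (mem_Iic.1 hx)]

lemma tendsto_lapCDF_atTop : Tendsto lapCDF atTop (𝓝 1) := by
  have h : Tendsto (fun x => 1 - Real.exp (-x) / 2) atTop (𝓝 1) := by
    simpa using (Real.tendsto_exp_neg_atTop_nhds_zero.div_const 2).const_sub 1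
  refine h.congr' ?_
  filter_upwards [Ioi_mem_atTop 0] with x hx
  rw [lapCDF_of_pos hx]

lemma integrable_pow_mul_lapDensity (k : ℕ) : Integrable fun x => x ^ k * lapDensity x := by
  have h := (integrableOn_pow_mul_exp_neg_mul_Ioi one_pos k).div_const 2
  refine integrable_of_halves ?_ ?_
  · refine IntegrableOn.congr_fun (h.const_mul ((-1) ^ k)) (fun x hx => ?_) measurableSet_Ioi
    simp only [lapDensity_neg, lapDensity_of_pos hx, neg_pow x, one_mul]
    ring
  · refine IntegrableOn.congr_fun h (fun x hx => ?_) measurableSet_Ioi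
    simp only [lapDensity_of_pos hx, one_mul]
    ring

lemma laplace_zero_one :
    laplace 0 1 = volume.withDensity fun x => ENNReal.ofReal (lapDensity x) := by
  unfold laplace lapDensity
  congr with x
  rw [sub_zero, div_one, mul_one, one_div, inv_mul_eq_div]

/-! ### The law of the maximum of `n` standard Laplace variables -/

/-- The density of the maximum of `n` standard Laplace variables. -/
noncomputable def lapMaxDensity (n : ℕ) (x : ℝ) : ℝ := n * lapCDF x ^ (n - 1) * lapDensity x

lemma lapMaxDensity_nonneg (n : ℕ) (x : ℝ) : 0 ≤ lapMaxDensity n x :=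
  mul_nonneg (mul_nonneg n.cast_nonneg (pow_nonneg (lapCDF_nonneg x) _)) (lapDensity_nonneg x)

lemma continuous_lapCDF : Continuous lapCDF :=
  continuous_iff_continuousAt.2 fun x => (hasDerivAt_lapCDF x).continuousAt

lemma continuous_lapMaxDensity (n : ℕ) : Continuous (lapMaxDensity n) :=
  (continuous_const.mul (continuous_lapCDF.pow _)).mul continuous_lapDensity

lemma integrable_pow_mul_lapMaxDensity (n k : ℕ) :
    Integrable fun x => x ^ k * lapMaxDensity n x := by
  have h := (integrable_pow_mul_lapDensity k).bdd_mul (c := n)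
    (f := fun x => n * lapCDF x ^ (n - 1))
    (continuous_const.mul (continuous_lapCDF.pow _)).aestronglyMeasurable
    (Eventually.of_forall fun x => by
      rw [norm_mul, norm_pow, Real.norm_of_nonneg (lapCDF_nonneg x), Real.norm_natCast]
      exact mul_le_of_le_one_right n.cast_nonneg (pow_le_one₀ (lapCDF_nonneg x) (lapCDF_le_one x)))
  refine h.congr (Eventually.of_forall fun x => ?_)
  simp only [lapMaxDensity]
  ring

lemma integrable_lapMaxDensity (n : ℕ) : Integrable (lapMaxDensity n) := by
  simpa using integrable_pow_mul_lapMaxDensity n 0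

lemma hasDerivAt_lapCDF_pow (n : ℕ) (x : ℝ) :
    HasDerivAt (fun x => lapCDF x ^ n) (lapMaxDensity n x) x :=
  (hasDerivAt_lapCDF x).pow n

lemma withDensity_lapMaxDensity_Iic {n : ℕ} (hn : n ≠ 0) (x : ℝ) :
    (volume.withDensity fun y => ENNReal.ofReal (lapMaxDensity n y)) (Iic x) =
      ENNReal.ofReal (lapCDF x ^ n) := by
  rw [withDensity_apply _ measurableSet_Iic, ← ofReal_integral_eq_lintegral_ofReal
    (integrable_lapMaxDensity n).integrableOn
    (Eventually.of_forall fun y => lapMaxDensity_nonneg n y),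
    integral_Iic_of_hasDerivAt_of_tendsto (m := 0) (f := fun x => lapCDF x ^ n)
      (hasDerivAt_lapCDF_pow n x).continuousAt.continuousWithinAt
      (fun y _ => hasDerivAt_lapCDF_pow n y) (integrable_lapMaxDensity n).integrableOn
      -- The limit at `-∞` is `0 ^ n`, which vanishes because `n ≠ 0`.
      (by simpa [hn] using tendsto_lapCDF_atBot.pow n), sub_zero]

/-- A single variable is the maximum of one, so its distribution function and moments are the case
`n = 1` of the results on maxima. -/
lemma lapMaxDensity_one : lapMaxDensity 1 = lapDensity := by
  ext x; simp [lapMaxDensity]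

lemma laplace_zero_one_Iic (x : ℝ) : laplace 0 1 (Iic x) = ENNReal.ofReal (lapCDF x) := by
  have h := withDensity_lapMaxDensity_Iic one_ne_zero x
  rwa [lapMaxDensity_one, ← laplace_zero_one, pow_one] at h

instance isProbabilityMeasure_laplace_zero_one : IsProbabilityMeasure (laplace 0 1) := by
  constructor
  have h := tendsto_measure_Iic_atTop (laplace 0 1)
  refine tendsto_nhds_unique h ?_
  simp_rw [laplace_zero_one_Iic]
  simpa using ENNReal.tendsto_ofReal tendsto_lapCDF_atTop

lemma laplace_eq_map (θ : ℝ) {δ : ℝ} (hδ : 0 < δ) :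
    laplace θ δ = (laplace 0 1).map fun x => θ + δ * x := by
  have hm : Measurable fun x : ℝ => θ + δ * x := by fun_prop
  have hsurj : Function.Surjective fun x : ℝ => θ + δ * x := fun y =>
    ⟨(y - θ) / δ, by field_simp; ring⟩
  have hinj : Function.Injective fun x : ℝ => θ + δ * x := fun a b h => by
    simpa [hδ.ne'] using h
  ext s hs
  rw [Measure.map_apply hm hs, laplace, withDensity_apply _ hs, laplace_zero_one,
    withDensity_apply _ (hm hs), ← image_preimage_eq s hsurj,
    lintegral_image_eq_lintegral_abs_deriv_mul (f' := fun _ => δ) (hm hs)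
      (fun x _ => by simpa using (((hasDerivAt_id x).const_mul δ).const_add θ).hasDerivWithinAt)
      hinj.injOn, image_preimage_eq s hsurj]
  refine lintegral_congr fun x => ?_
  rw [← ENNReal.ofReal_mul (abs_nonneg _), abs_of_pos hδ, lapDensity, add_sub_cancel_left, abs_mul,
    abs_of_pos hδ, mul_div_cancel_left₀ _ hδ.ne']
  congr 1
  field_simp

lemma isProbabilityMeasure_laplace (θ : ℝ) {δ : ℝ} (hδ : 0 < δ) :
    IsProbabilityMeasure (laplace θ δ) := by
  rw [laplace_eq_map θ hδ]
  exact Measure.isProbabilityMeasure_map (by fun_prop)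

/-- The law of `n` independent standard Laplace variables. -/
noncomputable def lapPi (n : ℕ) : Measure (Fin n → ℝ) := Measure.pi fun _ => laplace 0 1

instance (n : ℕ) : IsProbabilityMeasure (lapPi n) := by unfold lapPi; infer_instance

lemma measurable_iSup_coord (n : ℕ) : Measurable fun Y : Fin n → ℝ => ⨆ j, Y j :=
  Measurable.iSup fun j => measurable_pi_apply j

/-- The maximum is at most `x` exactly on the box `∏ (-∞, x]`, whose product measure is `F(x)^n`;
distribution functions determine finite measures. -/
lemma map_iSup_lapPi {n : ℕ} (hn : n ≠ 0) :
    (lapPi n).map (fun Y => ⨆ j, Y j) =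
      volume.withDensity fun y => ENNReal.ofReal (lapMaxDensity n y) := by
  have : Nonempty (Fin n) := ⟨⟨0, Nat.pos_of_ne_zero hn⟩⟩
  have : IsProbabilityMeasure ((lapPi n).map (fun Y => ⨆ j, Y j)) :=
    Measure.isProbabilityMeasure_map (measurable_iSup_coord n).aemeasurable
  refine Measure.ext_of_Iic _ _ fun x => ?_
  rw [Measure.map_apply (measurable_iSup_coord n) measurableSet_Iic,
    withDensity_lapMaxDensity_Iic hn]
  have : (fun Y : Fin n → ℝ => ⨆ j, Y j) ⁻¹' Iic x = univ.pi fun _ => Iic x := by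
    ext Y
    simp [ciSup_le_iff (finite_range Y).bddAbove, Pi.le_def]
  rw [this, lapPi, Measure.pi_pi]
  simp [laplace_zero_one_Iic, ENNReal.ofReal_pow (lapCDF_nonneg x)]

/-! ### Moments of the maximum of standard Laplace variables -/

lemma integral_pow_mul_lapMaxDensity {n : ℕ} (hn : n ≠ 0) (k : ℕ) :
    ∫ x, x ^ k * lapMaxDensity n x = k.factorial * n * alpha n n k := by
  have hi := integrable_pow_mul_lapMaxDensity n k
  have hi' : Integrable fun x => (-x) ^ k * lapMaxDensity n (-x) := hi.comp_neg
  rw [integral_eq_add_halves hi'.integrableOn hi.integrableOn]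
  have hpos : (0 : ℝ) < n := by positivity
  -- On the negative half line `F = f = exp/2`, so the density is the single exponential `n exp(-n
  -- x) / 2 ^ n` at `-x`.
  have e1 : ∫ x in Ioi (0 : ℝ), (-x) ^ k * lapMaxDensity n (-x) =
      ((-1) ^ k * n / 2 ^ n) * (k.factorial / (n : ℝ) ^ (k + 1)) := by
    rw [← integral_pow_mul_exp_neg_mul_Ioi hpos k, ← integral_const_mul]
    refine setIntegral_congr_fun measurableSet_Ioi fun x hx => ?_
    obtain ⟨m, rfl⟩ := Nat.exists_eq_succ_of_ne_zero hn
    simp only [lapMaxDensity, lapCDF_neg_of_pos hx, lapDensity_neg, lapDensity_of_pos hx, neg_pow x]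
    rw [Real.exp_neg ((m.succ : ℝ) * x), mul_comm (m.succ : ℝ) x, Real.exp_mul, Real.rpow_natCast,
      Real.exp_neg x, Nat.succ_sub_one, pow_succ (Real.exp x), pow_succ (2 : ℝ), div_pow, inv_pow]
    field_simp
  -- On the positive half line `(1 - exp(-x)/2)^(n-1)` is expanded by the binomial theorem.
  have e2 : ∫ x in Ioi (0 : ℝ), x ^ k * lapMaxDensity n x =
      ∑ j ∈ Finset.range n, (n * ((-1) ^ j * ((n - 1).choose j : ℝ) / 2 ^ (1 + j))) *
        (k.factorial / ((1 + j : ℕ) : ℝ) ^ (k + 1)) := by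
    have : ∀ j ∈ Finset.range n,
        (n * ((-1) ^ j * ((n - 1).choose j : ℝ) / 2 ^ (1 + j))) *
          (k.factorial / ((1 + j : ℕ) : ℝ) ^ (k + 1)) =
        ∫ x in Ioi (0 : ℝ), (n * ((-1) ^ j * ((n - 1).choose j : ℝ) / 2 ^ (1 + j))) *
          (x ^ k * Real.exp (-(((1 + j : ℕ) : ℝ) * x))) := fun j _ => by
      rw [integral_const_mul, integral_pow_mul_exp_neg_mul_Ioi (by positivity) k]
    rw [Finset.sum_congr rfl this, ← integral_finsetSum]
    · refine setIntegral_congr_fun measurableSet_Ioi fun x hx => ?_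
      obtain ⟨m, rfl⟩ := Nat.exists_eq_succ_of_ne_zero hn
      simp only [lapMaxDensity, lapCDF_of_pos hx, lapDensity_of_pos hx, Nat.succ_sub_one]
      rw [sub_eq_neg_add, add_pow, Finset.mul_sum, Finset.sum_mul, Finset.mul_sum]
      refine Finset.sum_congr rfl fun j _ => ?_
      have hx' : Real.exp (-(((1 + j : ℕ) : ℝ) * x)) = Real.exp (-x) * Real.exp (-x) ^ j := by
        rw [← Real.exp_nat_mul, ← Real.exp_add]
        congr 1
        push_cast
        ring
      rw [hx', one_pow, neg_pow (Real.exp (-x) / 2), div_pow, pow_add]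
      field_simp
    · exact fun j _ => (integrableOn_pow_mul_exp_neg_mul_Ioi (by positivity) k).const_mul _
  -- For `r = n` the first sum of `alpha` has only the term `j = 0`, which is the negative half; the
  -- second sum is the positive half.
  rw [e1, e2, alpha, mul_add, Nat.sub_self]
  congr 1
  · simp
    field_simp
  · rw [Finset.mul_sum]
    refine Finset.sum_congr rfl fun j _ => ?_
    rw [zero_add]
    field_simp

lemma integrable_withDensity_lapMaxDensity (n k : ℕ) :
    Integrable (fun x => x ^ k)
      (volume.withDensity fun y => ENNReal.ofReal (lapMaxDensity n y)) := by
  rw [integrable_withDensity_iff_integrable_smul'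
    (continuous_lapMaxDensity n).measurable.ennreal_ofReal (by simp)]
  refine (integrable_pow_mul_lapMaxDensity n k).congr (Eventually.of_forall fun x => ?_)
  simp [ENNReal.toReal_ofReal (lapMaxDensity_nonneg n x), mul_comm]

lemma integrable_iSup_pow_lapPi {n : ℕ} (hn : n ≠ 0) (k : ℕ) :
    Integrable (fun Y : Fin n → ℝ => (⨆ j, Y j) ^ k) (lapPi n) := by
  have h := integrable_withDensity_lapMaxDensity n k
  rw [← map_iSup_lapPi hn] at h
  exact h.comp_measurable (measurable_iSup_coord n)

lemma integral_iSup_pow_lapPi {n : ℕ} (hn : n ≠ 0) (k : ℕ) :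
    ∫ Y : Fin n → ℝ, (⨆ j, Y j) ^ k ∂lapPi n = k.factorial * n * alpha n n k := by
  rw [← integral_pow_mul_lapMaxDensity hn k,
    ← integral_map (f := fun x : ℝ => x ^ k) (measurable_iSup_coord n).aemeasurable
      (by fun_prop), map_iSup_lapPi hn, integral_withDensity_eq_integral_toReal_smul
      (continuous_lapMaxDensity n).measurable.ennreal_ofReal (by simp)]
  refine integral_congr_ae (Eventually.of_forall fun x => ?_)
  simp [ENNReal.toReal_ofReal (lapMaxDensity_nonneg n x), mul_comm]

/-! ### First and second moments of `A - B X` for independent `A`, `B`, `X` -/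

section Product

variable {α β γ : Type*} [MeasurableSpace α] [MeasurableSpace β] [MeasurableSpace γ]
  {μ : Measure α} {ν : Measure β} {ρ : Measure γ} {A : α → ℝ} {B : β → ℝ} {X : γ → ℝ}

lemma integral_prod_three [SFinite μ] [SFinite ν] [SFinite ρ] (A : α → ℝ) (B : β → ℝ) (X : γ → ℝ) :
    ∫ z, A z.1.1 * B z.1.2 * X z.2 ∂((μ.prod ν).prod ρ) =
      (∫ a, A a ∂μ) * (∫ b, B b ∂ν) * ∫ x, X x ∂ρ := by
  rw [integral_prod_mul (f := fun z : α × β => A z.1 * B z.2) (g := X), integral_prod_mul]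

lemma integrable_prod_three [SFinite ν] [SFinite ρ] (hA : Integrable A μ)
    (hB : Integrable B ν) (hX : Integrable X ρ) :
    Integrable (fun z : (α × β) × γ => A z.1.1 * B z.1.2 * X z.2) ((μ.prod ν).prod ρ) :=
  (hA.mul_prod hB).mul_prod hX

variable [IsProbabilityMeasure μ] [IsProbabilityMeasure ν] [IsProbabilityMeasure ρ]

lemma memLp_two_prod_three (hA : MemLp A 2 μ) (hB : MemLp B 2 ν) (hX : MemLp X 2 ρ) :
    MemLp (fun z : (α × β) × γ => A z.1.1 * B z.1.2 * X z.2) 2 ((μ.prod ν).prod ρ) := by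
  refine (memLp_two_iff_integrable_sq (integrable_prod_three (hA.integrable one_le_two)
    (hB.integrable one_le_two) (hX.integrable one_le_two)).aestronglyMeasurable).2 ?_
  simp_rw [mul_pow]
  exact integrable_prod_three hA.integrable_sq hB.integrable_sq hX.integrable_sq

lemma memLp_two_sub_mul (hA : MemLp A 2 μ) (hB : MemLp B 2 ν) (hX : MemLp X 2 ρ) :
    MemLp (fun z : (α × β) × γ => A z.1.1 - B z.1.2 * X z.2) 2 ((μ.prod ν).prod ρ) := by
  -- Constant factors `1` make both `A` and `B X` instances of the triple product.
  have h1 := memLp_two_prod_three hA (memLp_const (μ := ν) (1 : ℝ)) (memLp_const (μ := ρ) (1 : ℝ))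
  have h2 := memLp_two_prod_three (memLp_const (μ := μ) (1 : ℝ)) hB hX
  simp only [mul_one, one_mul] at h1 h2
  exact h1.sub h2

lemma integral_sub_mul (hA : MemLp A 2 μ) (hB : MemLp B 2 ν) (hX : MemLp X 2 ρ) :
    ∫ z, (A z.1.1 - B z.1.2 * X z.2) ∂((μ.prod ν).prod ρ) =
      (∫ a, A a ∂μ) - (∫ b, B b ∂ν) * ∫ x, X x ∂ρ := by
  have h1 := memLp_two_prod_three hA (memLp_const (μ := ν) (1 : ℝ)) (memLp_const (μ := ρ) (1 : ℝ))
  have h2 := memLp_two_prod_three (memLp_const (μ := μ) (1 : ℝ)) hB hX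
  have e1 := integral_prod_three (μ := μ) (ν := ν) (ρ := ρ) A (fun _ => 1) (fun _ => 1)
  have e2 := integral_prod_three (μ := μ) (ν := ν) (ρ := ρ) (fun _ => 1) B X
  simp only [mul_one, one_mul, integral_const, probReal_univ, smul_eq_mul] at h1 h2 e1 e2
  rw [integral_sub (h1.integrable one_le_two) (h2.integrable one_le_two), e1, e2]

lemma integral_sub_mul_sq (hA : MemLp A 2 μ) (hB : MemLp B 2 ν) (hX : MemLp X 2 ρ) :
    ∫ z, (A z.1.1 - B z.1.2 * X z.2) ^ 2 ∂((μ.prod ν).prod ρ) =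
      (∫ a, A a ^ 2 ∂μ) - 2 * ((∫ a, A a ∂μ) * (∫ b, B b ∂ν) * ∫ x, X x ∂ρ)
        + (∫ b, B b ^ 2 ∂ν) * ∫ x, X x ^ 2 ∂ρ := by
  have i1 := integrable_prod_three hA.integrable_sq (integrable_const (μ := ν) (1 : ℝ))
    (integrable_const (μ := ρ) (1 : ℝ))
  have i2 := integrable_prod_three (hA.integrable one_le_two) (hB.integrable one_le_two)
    (hX.integrable one_le_two)
  have i3 := integrable_prod_three (integrable_const (μ := μ) (1 : ℝ)) hB.integrable_sq
    hX.integrable_sq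
  have e1 := integral_prod_three (μ := μ) (ν := ν) (ρ := ρ) (fun a => A a ^ 2) (fun _ => 1)
    (fun _ => 1)
  have e3 := integral_prod_three (μ := μ) (ν := ν) (ρ := ρ) (fun _ => 1) (fun b => B b ^ 2)
    (fun x => X x ^ 2)
  simp only [mul_one, one_mul, integral_const, probReal_univ, smul_eq_mul] at i1 i3 e1 e3
  have i4 : Integrable (fun z : (α × β) × γ =>
      A z.1.1 ^ 2 - 2 * (A z.1.1 * B z.1.2 * X z.2)) ((μ.prod ν).prod ρ) := i1.sub (i2.const_mul 2)
  rw [← e1, ← e3, ← integral_prod_three, ← integral_const_mul,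
    ← integral_sub i1 (i2.const_mul 2), ← integral_add i4 i3]
  refine integral_congr_ae (Eventually.of_forall fun z => ?_)
  ring

end Product

section Affine

variable {Ω : Type*} [MeasurableSpace Ω] {P : Measure Ω} {X : Ω → ℝ}

lemma integrable_affine_pow (hX : ∀ k : ℕ, Integrable (fun ω => X ω ^ k) P) (a b : ℝ) (k : ℕ) :
    Integrable (fun ω => (b * X ω + a) ^ k) P := by
  simp_rw [add_pow, mul_pow]
  exact integrable_finsetSum _ fun j _ => (((hX j).const_mul _).mul_const _).mul_const _

lemma integral_affine_pow (hX : ∀ k : ℕ, Integrable (fun ω => X ω ^ k) P) (a b : ℝ) (k : ℕ) :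
    ∫ ω, (b * X ω + a) ^ k ∂P =
      ∑ j ∈ Finset.range (k + 1), b ^ j * (∫ ω, X ω ^ j ∂P) * a ^ (k - j) * k.choose j := by
  simp_rw [add_pow, mul_pow]
  rw [integral_finsetSum _ fun j _ => (((hX j).const_mul _).mul_const _).mul_const _]
  refine Finset.sum_congr rfl fun j _ => ?_
  rw [integral_mul_const, integral_mul_const, integral_const_mul]

lemma memLp_two_affine_pow (hX : ∀ k : ℕ, Integrable (fun ω => X ω ^ k) P) (a b : ℝ) (k : ℕ) :
    MemLp (fun ω => (b * X ω + a) ^ k) 2 P := by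
  refine (memLp_two_iff_integrable_sq (integrable_affine_pow hX a b k).aestronglyMeasurable).2 ?_
  simp_rw [← pow_mul]
  exact integrable_affine_pow hX a b _

end Affine

/-! ### Moments of a standard Laplace variable -/

lemma laplace_zero_one_eq_lapMaxDensity :
    laplace 0 1 = volume.withDensity fun y => ENNReal.ofReal (lapMaxDensity 1 y) := by
  rw [lapMaxDensity_one, laplace_zero_one]

lemma integrable_pow_laplace (k : ℕ) : Integrable (fun x => x ^ k) (laplace 0 1) := by
  rw [laplace_zero_one_eq_lapMaxDensity]
  exact integrable_withDensity_lapMaxDensity 1 k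

lemma integral_pow_laplace (k : ℕ) :
    ∫ x, x ^ k ∂laplace 0 1 = k.factorial * alpha 1 1 k := by
  have h := integral_pow_mul_lapMaxDensity one_ne_zero k
  rw [Nat.cast_one, mul_one] at h
  rw [← h, laplace_zero_one_eq_lapMaxDensity, integral_withDensity_eq_integral_toReal_smul
      (continuous_lapMaxDensity 1).measurable.ennreal_ofReal (by simp)]
  refine integral_congr_ae (Eventually.of_forall fun x => ?_)
  simp [ENNReal.toReal_ofReal (lapMaxDensity_nonneg 1 x), mul_comm]

lemma alpha_one_one (k : ℕ) : alpha 1 1 k = ((-1) ^ k + 1) / 2 := by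
  simp [alpha]; ring

/-- This is the total mass of the law of the maximum, read off from the zeroth moment. It produces
the pure powers of `θ` in the `Λ`'s. -/
lemma alpha_self_zero {n : ℕ} (hn : n ≠ 0) : n * alpha n n 0 = 1 := by
  have h := integral_iSup_pow_lapPi hn 0
  simpa using h.symm

/-- The reflection `x ↦ -x` exchanges minimum and maximum; in `alpha` it exchanges the two sums. -/
lemma alpha_one_right {n : ℕ} (hn : n ≠ 0) (k : ℕ) : alpha n 1 k = (-1) ^ k * alpha n n k := by
  obtain ⟨m, rfl⟩ := Nat.exists_eq_succ_of_ne_zero hn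
  simp only [alpha, Nat.succ_sub_one, Nat.sub_self, mul_add, ← mul_assoc, ← mul_pow]
  simp [add_comm]

lemma map_neg_laplace : (laplace 0 1).map (fun x => -x) = laplace 0 1 := by
  ext s hs
  rw [Measure.map_apply measurable_neg hs, laplace_zero_one, withDensity_apply _ hs,
    withDensity_apply _ (measurable_neg hs),
    ← (Measure.measurePreserving_neg (volume : Measure ℝ)).setLIntegral_comp_preimage hs
      continuous_lapDensity.measurable.ennreal_ofReal]
  simp [lapDensity_neg]

/-- The minus sign is chosen because `min (θ - δ Y_j) = θ - δ max Y_j`, so that minima need no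
separate computation. -/
lemma laplace_eq_map_sub (θ : ℝ) {δ : ℝ} (hδ : 0 < δ) :
    laplace θ δ = (laplace 0 1).map fun x => θ - δ * x := by
  conv_lhs => rw [laplace_eq_map θ hδ, ← map_neg_laplace]
  rw [Measure.map_map (by fun_prop) (by fun_prop)]
  congr 1
  ext x
  simp [sub_eq_add_neg]

/-! ### Moments of `phi` -/

/-- The affine map that turns standard Laplace variables into those of `noiseLaw`. -/
def noiseMap (n : ℕ) (θmax θmin θout δ : ℝ) (ω : ((Fin n → ℝ) × (Fin n → ℝ)) × ℝ) :
    ((Fin n → ℝ) × (Fin n → ℝ)) × ℝ :=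
  ((fun j => θmax + δ * ω.1.1 j, fun j => θmin - δ * ω.1.2 j), θout + δ * ω.2)

lemma measurable_noiseMap (n : ℕ) (θmax θmin θout δ : ℝ) :
    Measurable (noiseMap n θmax θmin θout δ) := by
  unfold noiseMap
  fun_prop

lemma noiseLaw_eq_map (n : ℕ) (θmax θmin θout : ℝ) {δ : ℝ} (hδ : 0 < δ) :
    noiseLaw n θmax θmin θout δ =
      (((lapPi n).prod (lapPi n)).prod (laplace 0 1)).map (noiseMap n θmax θmin θout δ) := by
  have := isProbabilityMeasure_laplace θmax hδ
  have := isProbabilityMeasure_laplace θmin hδ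
  have := isProbabilityMeasure_laplace θout hδ
  have h1 : (Measure.pi fun _ : Fin n => laplace θmax δ) =
      (lapPi n).map fun Y j => θmax + δ * Y j := by
    rw [lapPi, Measure.pi_map_pi (f := fun _ x => θmax + δ * x) fun _ => by fun_prop]
    simp_rw [← laplace_eq_map θmax hδ]
  have h2 : (Measure.pi fun _ : Fin n => laplace θmin δ) =
      (lapPi n).map fun Y j => θmin - δ * Y j := by
    rw [lapPi, Measure.pi_map_pi (f := fun _ x => θmin - δ * x) fun _ => by fun_prop]
    simp_rw [← laplace_eq_map_sub θmin hδ]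
  rw [noiseLaw, h1, h2, laplace_eq_map θout hδ,
    Measure.map_prod_map _ _ (by fun_prop) (by fun_prop),
    Measure.map_prod_map _ _ (by fun_prop) (by fun_prop)]
  rfl

/-- The exponents `1` put all three factors in the form treated by the affine power lemmas. -/
lemma phi_noiseMap {n : ℕ} (hn : n ≠ 0) (θmax θmin θout : ℝ) {δ : ℝ} (hδ : 0 < δ)
    (ω : ((Fin n → ℝ) × (Fin n → ℝ)) × ℝ) :
    phi n (noiseMap n θmax θmin θout δ ω) =
      (δ * (⨆ j, ω.1.1 j) + θmax) ^ 2 -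
        ((-δ) * (⨆ j, ω.1.2 j) + θmin) ^ 1 * (δ * ω.2 + θout) ^ 1 := by
  have : Nonempty (Fin n) := ⟨⟨0, Nat.pos_of_ne_zero hn⟩⟩
  have h1 : ⨆ j, (θmax + δ * ω.1.1 j) = θmax + δ * ⨆ j, ω.1.1 j := by
    have hm : Monotone fun x : ℝ => θmax + δ * x := fun a b h =>
      add_le_add_right (mul_le_mul_of_nonneg_left h hδ.le) θmax
    exact (hm.map_ciSup_of_continuousAt (Continuous.continuousAt (by fun_prop))
      (finite_range _).bddAbove).symm
  have h2 : ⨅ j, (θmin - δ * ω.1.2 j) = θmin - δ * ⨆ j, ω.1.2 j := by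
    have hm : Antitone fun x : ℝ => θmin - δ * x := fun a b h =>
      sub_le_sub_left (mul_le_mul_of_nonneg_left h hδ.le) θmin
    exact (hm.map_ciSup_of_continuousAt (Continuous.continuousAt (by fun_prop))
      (finite_range _).bddAbove).symm
  simp only [phi, noiseMap, h1, h2]
  ring

lemma measurable_phi (n : ℕ) : Measurable (phi n) := by
  have h1 : Measurable fun ω : ((Fin n → ℝ) × (Fin n → ℝ)) × ℝ => ⨆ j, ω.1.1 j :=
    Measurable.iSup fun j => by fun_prop
  have h2 : Measurable fun ω : ((Fin n → ℝ) × (Fin n → ℝ)) × ℝ => ⨅ j, ω.1.2 j :=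
    Measurable.iInf fun j => by fun_prop
  exact (h1.pow_const 2).sub (h2.mul measurable_snd)

lemma integral_iSup_pow_four_eq_Lam1 {n : ℕ} (hn : n ≠ 0) (θ δ : ℝ) :
    ∫ Y : Fin n → ℝ, ((δ * (⨆ j, Y j) + θ) ^ 2) ^ 2 ∂lapPi n = Lam1 n θ δ := by
  simp only [← pow_mul]
  simp only [integral_affine_pow (integrable_iSup_pow_lapPi hn), integral_iSup_pow_lapPi hn,
    Finset.sum_range_succ, Lam1, Finset.sum_range_zero]
  norm_num [Nat.choose, Nat.factorial, alpha_self_zero hn]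
  ring

lemma integral_iInf_sq_eq_Lam2 {n : ℕ} (hn : n ≠ 0) (θ δ : ℝ) :
    ∫ Y : Fin n → ℝ, (((-δ) * (⨆ j, Y j) + θ) ^ 1) ^ 2 ∂lapPi n = Lam2 n θ δ := by
  simp only [← pow_mul]
  simp only [integral_affine_pow (integrable_iSup_pow_lapPi hn), integral_iSup_pow_lapPi hn,
    Finset.sum_range_succ, Lam2, Finset.sum_range_zero, alpha_one_right hn]
  norm_num [Nat.choose, Nat.factorial, alpha_self_zero hn]
  ring

lemma integral_iSup_sq_eq_Lam3 {n : ℕ} (hn : n ≠ 0) (θ δ : ℝ) :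
    ∫ Y : Fin n → ℝ, (δ * (⨆ j, Y j) + θ) ^ 2 ∂lapPi n = Lam3 n θ δ := by
  simp only [integral_affine_pow (integrable_iSup_pow_lapPi hn), integral_iSup_pow_lapPi hn,
    Finset.sum_range_succ, Lam3, Finset.sum_range_zero]
  norm_num [Nat.choose, Nat.factorial, alpha_self_zero hn]
  ring

lemma integral_iInf_eq_Lam4 {n : ℕ} (hn : n ≠ 0) (θ δ : ℝ) :
    ∫ Y : Fin n → ℝ, ((-δ) * (⨆ j, Y j) + θ) ^ 1 ∂lapPi n = Lam4 n θ δ := by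
  simp only [integral_affine_pow (integrable_iSup_pow_lapPi hn), integral_iSup_pow_lapPi hn,
    Finset.sum_range_succ, Lam4, Finset.sum_range_zero, alpha_one_right hn]
  norm_num [Nat.choose, Nat.factorial, alpha_self_zero hn]
  ring

lemma Lam3_sq_le_Lam1 {n : ℕ} (hn : n ≠ 0) (θ δ : ℝ) : Lam3 n θ δ ^ 2 ≤ Lam1 n θ δ := by
  have h := variance_eq_sub (memLp_two_affine_pow (integrable_iSup_pow_lapPi hn) θ δ 2)
  simp only [Pi.pow_apply] at h
  rw [integral_iSup_pow_four_eq_Lam1 hn, integral_iSup_sq_eq_Lam3 hn] at h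
  linarith [variance_nonneg (fun Y : Fin n → ℝ => (δ * (⨆ j, Y j) + θ) ^ 2) (lapPi n)]

lemma Lam4_sq_le_Lam2 {n : ℕ} (hn : n ≠ 0) (θ δ : ℝ) : Lam4 n θ δ ^ 2 ≤ Lam2 n θ δ := by
  have h := variance_eq_sub (memLp_two_affine_pow (integrable_iSup_pow_lapPi hn) θ (-δ) 1)
  simp only [Pi.pow_apply] at h
  rw [integral_iInf_sq_eq_Lam2 hn, integral_iInf_eq_Lam4 hn] at h
  linarith [variance_nonneg (fun Y : Fin n → ℝ => ((-δ) * (⨆ j, Y j) + θ) ^ 1) (lapPi n)]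

theorem phi_moments {n : ℕ} (hn : n ≠ 0) (θmax θmin θout : ℝ) {δ : ℝ} (hδ : 0 < δ) :
    MemLp (phi n) 2 (noiseLaw n θmax θmin θout δ) ∧
      ∫ ω, phi n ω ∂(noiseLaw n θmax θmin θout δ) = Lam3 n θmax δ - θout * Lam4 n θmin δ ∧
      variance (phi n) (noiseLaw n θmax θmin θout δ) =
        Lam1 n θmax δ + (θout ^ 2 + 2 * δ ^ 2) * Lam2 n θmin δ
          - (Lam3 n θmax δ ^ 2 + θout ^ 2 * Lam4 n θmin δ ^ 2) := by
  have hM := integrable_iSup_pow_lapPi hn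
  have hA := memLp_two_affine_pow hM θmax δ 2
  have hB := memLp_two_affine_pow hM θmin (-δ) 1
  have hX := memLp_two_affine_pow integrable_pow_laplace θout δ 1
  have hcomp : phi n ∘ noiseMap n θmax θmin θout δ = fun ω =>
      (δ * (⨆ j, ω.1.1 j) + θmax) ^ 2 -
        ((-δ) * (⨆ j, ω.1.2 j) + θmin) ^ 1 * (δ * ω.2 + θout) ^ 1 :=
    funext (phi_noiseMap hn θmax θmin θout hδ)
  have hL : MemLp (phi n ∘ noiseMap n θmax θmin θout δ) 2
      (((lapPi n).prod (lapPi n)).prod (laplace 0 1)) := by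
    rw [hcomp]
    exact memLp_two_sub_mul hA hB hX
  have hm := measurable_noiseMap n θmax θmin θout δ
  have hX1 : ∫ x, (δ * x + θout) ^ 1 ∂laplace 0 1 = θout := by
    simp only [integral_affine_pow integrable_pow_laplace, integral_pow_laplace,
      Finset.sum_range_succ, alpha_one_one, Finset.sum_range_zero]
    norm_num
  have hX2 : ∫ x, ((δ * x + θout) ^ 1) ^ 2 ∂laplace 0 1 = θout ^ 2 + 2 * δ ^ 2 := by
    simp only [← pow_mul]
    simp only [integral_affine_pow integrable_pow_laplace, integral_pow_laplace,
      Finset.sum_range_succ, alpha_one_one, Finset.sum_range_zero]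
    norm_num [Nat.choose, Nat.factorial]
    ring
  have hE : ∫ ω, (phi n ∘ noiseMap n θmax θmin θout δ) ω
      ∂(((lapPi n).prod (lapPi n)).prod (laplace 0 1)) =
      Lam3 n θmax δ - θout * Lam4 n θmin δ := by
    rw [hcomp, integral_sub_mul hA hB hX, integral_iSup_sq_eq_Lam3 hn, integral_iInf_eq_Lam4 hn,
      hX1, mul_comm θout]
  have hE2 : ∫ ω, (phi n ∘ noiseMap n θmax θmin θout δ) ω ^ 2
      ∂(((lapPi n).prod (lapPi n)).prod (laplace 0 1)) =
      Lam1 n θmax δ - 2 * θout * Lam3 n θmax δ * Lam4 n θmin δ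
        + (θout ^ 2 + 2 * δ ^ 2) * Lam2 n θmin δ := by
    rw [hcomp, integral_sub_mul_sq hA hB hX, integral_iSup_pow_four_eq_Lam1 hn,
      integral_iInf_sq_eq_Lam2 hn, integral_iSup_sq_eq_Lam3 hn, integral_iInf_eq_Lam4 hn, hX1, hX2]
    ring
  rw [noiseLaw_eq_map n θmax θmin θout hδ]
  refine ⟨(memLp_map_measure_iff (measurable_phi n).aestronglyMeasurable hm.aemeasurable).2 hL,
    ?_, ?_⟩
  · rw [integral_map hm.aemeasurable (measurable_phi n).aestronglyMeasurable]
    exact hE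
  · rw [variance_map (measurable_phi n).aemeasurable hm.aemeasurable, variance_eq_sub hL, hE]
    simp only [Pi.pow_apply]
    rw [hE2]
    ring

/-! ### Stability of homogeneous separability under small perturbations -/

/-- The `τ²` terms cancel, and the linear ones compare by `2a ≤ b + c`, which follows from `4a² <
4bc ≤ (b + c)²`. -/
lemma sq_add_lt_mul_add {a b c τ : ℝ} (hb : 0 < b) (hc : 0 < c) (h : a ^ 2 < b * c)
    (hτ : 0 ≤ τ) : (a + τ) ^ 2 < (b + τ) * (c + τ) := by
  have h2 : 2 * a ≤ b + c := abs_le_of_sq_le_sq' (by nlinarith [sq_nonneg (b - c)]) (by linarith) |>.2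
  nlinarith

lemma exists_pos_sq_add_lt {M m W : ℝ} (hm : 0 < m) (h : M ^ 2 < m * W) :
    ∃ η > 0, 0 < m - η ∧ (M + η) ^ 2 < (m - η) * (W - η) := by
  have h1 : ∀ᶠ η in 𝓝 (0 : ℝ), 0 < m - η :=
    (Continuous.tendsto' (by fun_prop) 0 m (by simp)).eventually_const_lt hm
  have h2 : ∀ᶠ η in 𝓝 (0 : ℝ), 0 < (m - η) * (W - η) - (M + η) ^ 2 :=
    (Continuous.tendsto' (by fun_prop) 0 (m * W - M ^ 2) (by simp)).eventually_const_lt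
      (sub_pos.2 h)
  obtain ⟨η, ⟨h3, h4⟩, h5⟩ := (((h1.and h2).filter_mono nhdsWithin_le_nhds).and
    (self_mem_nhdsWithin (s := Ioi (0 : ℝ)))).exists
  exact ⟨η, h5, h3, sub_pos.1 h4⟩

lemma HomSep.exists_stable {ι : Type*} {w : ι → ℝ} {F : Finset ι} {e : ι} (h : HomSep w F e)
    (hw : ∀ f ∈ F, 0 < w f) :
    ∃ η > 0, ∀ Y : ι → ℝ, (∀ f, |Y f| ≤ η) → ∀ τ p : ℝ, 0 ≤ τ → 0 < p →
      HomSep (fun f => (w f + Y f + τ) / p) F e := by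
  obtain ⟨hF, -, h⟩ := h
  obtain ⟨f₀, hf₀⟩ := id hF
  have hm : 0 < F.inf' hF w := (Finset.lt_inf'_iff hF).2 hw
  have hM : 0 < F.sup' hF w := (hw f₀ hf₀).trans_le (Finset.le_sup' w hf₀)
  -- Clearing the denominator turns `α M < w e` into `M² < m · w e`.
  rw [div_mul_eq_mul_div, div_lt_iff₀ hm, ← sq, mul_comm] at h
  obtain ⟨η, hη, h1, h2⟩ := exists_pos_sq_add_lt hm h
  refine ⟨η, hη, fun Y hY τ p hτ hp => ⟨hF, ?_⟩⟩
  have h3 : 0 < w e - η := pos_of_mul_pos_right ((sq_nonneg _).trans_lt h2) h1.le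
  have h4 := sq_add_lt_mul_add h1 h3 h2 hτ
  set M' := F.sup' hF fun f => (w f + Y f + τ) / p
  set m' := F.inf' hF fun f => (w f + Y f + τ) / p
  have hm' : (F.inf' hF w - η + τ) / p ≤ m' := by
    refine Finset.le_inf' _ _ fun f hf => ?_
    have := Finset.inf'_le w hf
    have := (abs_le.1 (hY f)).1
    gcongr
    linarith
  have hM' : M' ≤ (F.sup' hF w + η + τ) / p := by
    refine Finset.sup'_le _ _ fun f hf => ?_
    have := Finset.le_sup' w hf
    have := (abs_le.1 (hY f)).2
    gcongr
  have hmM : m' ≤ M' := (Finset.inf'_le _ hf₀).trans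
    (Finset.le_sup' (fun f => (w f + Y f + τ) / p) hf₀)
  have he : (w e - η + τ) / p ≤ (w e + Y e + τ) / p := by
    have := (abs_le.1 (hY e)).1
    gcongr
    linarith
  have hpos : 0 < (F.inf' hF w - η + τ) / p := by positivity
  have hpos' : 0 < (w e - η + τ) / p := by positivity
  have hm'pos := hpos.trans_le hm'
  refine ⟨(one_le_div hm'pos).2 hmM, ?_⟩
  rw [div_mul_eq_mul_div, div_lt_iff₀ hm'pos]
  calc M' * M' ≤ ((F.sup' hF w + η + τ) / p) * ((F.sup' hF w + η + τ) / p) :=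
        mul_le_mul hM' hM' (hm'pos.le.trans hmM) ((hm'pos.le.trans hmM).trans hM')
    _ = (F.sup' hF w + η + τ) ^ 2 / (p * p) := by ring
    _ < ((F.inf' hF w - η + τ) * (w e - η + τ)) / (p * p) := by gcongr
    _ = ((w e - η + τ) / p) * ((F.inf' hF w - η + τ) / p) := by ring
    _ ≤ (w e + Y e + τ) / p * m' := mul_le_mul he hm' hpos.le (hpos'.le.trans he)

/-! ### Tails of the Weight-Release mechanism -/

lemma one_sub_exp_neg_le_laplace_Icc {t : ℝ} (ht : 0 < t) :
    1 - Real.exp (-t) ≤ (laplace 0 1).real (Icc (-t) t) := by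
  have h : ∀ x, (laplace 0 1).real (Iic x) = lapCDF x := fun x => by
    rw [measureReal_def, laplace_zero_one_Iic, ENNReal.toReal_ofReal (lapCDF_nonneg x)]
  have h1 : (laplace 0 1).real (Ioc (-t) t) = 1 - Real.exp (-t) := by
    have e : Ioc (-t) t = Iic t \ Iic (-t) := by
      ext x
      simp [and_comm]
    rw [e, measureReal_sdiff (Iic_subset_Iic.2 (by linarith)) measurableSet_Iic, h, h,
      lapCDF_of_pos ht, lapCDF_neg_of_pos ht]
    ring
  rw [← h1]
  exact measureReal_mono Ioc_subset_Icc_self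

lemma one_sub_exp_neg_le_laplace {s η : ℝ} (hs : 0 < s) (hη : 0 < η) :
    1 - Real.exp (-(η / s)) ≤ (laplace 0 s).real (Icc (-η) η) := by
  rw [laplace_eq_map 0 hs, map_measureReal_apply (by fun_prop) measurableSet_Icc]
  refine (one_sub_exp_neg_le_laplace_Icc (div_pos hη hs)).trans (measureReal_mono ?_)
  intro x hx
  have h1 := mul_le_mul_of_nonneg_left hx.1 hs.le
  have h2 := mul_le_mul_of_nonneg_left hx.2 hs.le
  rw [mul_neg, mul_div_cancel₀ _ hs.ne'] at h1
  rw [mul_div_cancel₀ _ hs.ne'] at h2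
  simpa using And.intro h1 h2

lemma one_sub_le_weightRelease {E : Type*} [Fintype E] (w : E → ℝ) {s η τ p : ℝ} (hs : 0 < s)
    (hη : 0 < η) {S : Set (E → ℝ)}
    (hS : ∀ Y : E → ℝ, (∀ f, |Y f| ≤ η) → (fun f => (w f + Y f + τ) / p) ∈ S) :
    1 - Fintype.card E * Real.exp (-(η / s)) ≤ (weightRelease w s τ p).real S := by
  have := isProbabilityMeasure_laplace 0 hs
  have hm : Measurable fun (Y : E → ℝ) e => (w e + Y e + τ) / p := by fun_prop
  have : IsProbabilityMeasure (weightRelease w s τ p) :=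
    Measure.isProbabilityMeasure_map hm.aemeasurable
  have h1 : (Measure.pi fun _ : E => laplace 0 s).real (univ.pi fun _ => Icc (-η) η) ≤
      (weightRelease w s τ p).real S := by
    -- `Measure.le_map_apply` bounds the image measure from below on arbitrary sets, so `S` need not
    -- be measurable.
    refine ENNReal.toReal_mono (measure_ne_top _ _)
      (le_trans (measure_mono ?_) (Measure.le_map_apply hm.aemeasurable S))
    intro Y hY
    exact hS Y fun f => abs_le.2 (hY f trivial)
  refine le_trans ?_ h1
  have h2 : Real.exp (-(η / s)) ≤ 1 := Real.exp_le_one_iff.2 (by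
    have := div_pos hη hs
    linarith)
  rw [measureReal_def, Measure.pi_pi, ENNReal.toReal_prod, Finset.prod_const, Finset.card_univ]
  -- Bernoulli's inequality plays the role of a union bound over the edges.
  have h3 := one_add_mul_le_pow (a := -Real.exp (-(η / s))) (by linarith) (Fintype.card E)
  calc 1 - Fintype.card E * Real.exp (-(η / s))
      = 1 + Fintype.card E * -Real.exp (-(η / s)) := by ring
    _ ≤ (1 + -Real.exp (-(η / s))) ^ Fintype.card E := h3
    _ ≤ _ := pow_le_pow_left₀ (by linarith) (one_sub_exp_neg_le_laplace hs hη) _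

lemma eventually_mul_exp_neg_div_le {η c : ℝ} (N : ℝ) (hη : 0 < η) (hc : 0 < c) (hN : 0 ≤ N) :
    ∀ᶠ s in 𝓝[>] (0 : ℝ), N * Real.exp (-(η / s)) ≤ c * s ^ 2 := by
  have h : ∀ᶠ s in 𝓝[>] (0 : ℝ), 6 * N / η ^ 3 * s < c :=
    ((Continuous.tendsto' (by fun_prop) 0 0 (by simp)).eventually_lt_const hc).filter_mono
      nhdsWithin_le_nhds
  filter_upwards [h, self_mem_nhdsWithin] with s hs (hs0 : 0 < s)
  -- The cubic term of the exponential series suffices: `s³` is negligible against `s²`.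
  have h1 := Real.pow_div_factorial_le_exp (η / s) (by positivity) 3
  have h2 : Real.exp (-(η / s)) ≤ 6 * s ^ 3 / η ^ 3 := by
    rw [Real.exp_neg]
    refine (inv_anti₀ (by positivity) h1).trans_eq ?_
    simp [Nat.factorial]
    field_simp
  calc N * Real.exp (-(η / s)) ≤ N * (6 * s ^ 3 / η ^ 3) := by gcongr
    _ = (6 * N / η ^ 3 * s) * s ^ 2 := by ring
    _ ≤ c * s ^ 2 := by gcongr

/-! ### A lower bound for the variance ratio -/

/-- The mean of `phi`. -/
noncomputable def phiMean (n : ℕ) (θmax θmin θout δ : ℝ) : ℝ :=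
  Lam3 n θmax δ - θout * Lam4 n θmin δ

/-- The variance of `phi`. -/
noncomputable def phiVar (n : ℕ) (θmax θmin θout δ : ℝ) : ℝ :=
  Lam1 n θmax δ + (θout ^ 2 + 2 * δ ^ 2) * Lam2 n θmin δ
    - (Lam3 n θmax δ ^ 2 + θout ^ 2 * Lam4 n θmin δ ^ 2)

lemma phiMean_div (n : ℕ) (θmax θmin θout δ : ℝ) {p : ℝ} (hp : p ≠ 0) :
    phiMean n (θmax / p) (θmin / p) (θout / p) (δ / p) = phiMean n θmax θmin θout δ / p ^ 2 := by
  simp only [phiMean, Lam3, Lam4]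
  field_simp

lemma phiVar_div (n : ℕ) (θmax θmin θout δ : ℝ) {p : ℝ} (hp : p ≠ 0) :
    phiVar n (θmax / p) (θmin / p) (θout / p) (δ / p) = phiVar n θmax θmin θout δ / p ^ 4 := by
  simp only [phiVar, Lam1, Lam2, Lam3, Lam4]
  field_simp

/-- The variance is `V(A) + θ² V(B) + 2δ² E(B²)`. The first two terms are nonnegative and `E(B²) ≥
E(B)²`. -/
lemma two_mul_sq_mul_Lam4_sq_le_phiVar {n : ℕ} (hn : n ≠ 0) (θmax θmin θout δ : ℝ) :
    2 * δ ^ 2 * Lam4 n θmin δ ^ 2 ≤ phiVar n θmax θmin θout δ := by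
  have h1 := Lam3_sq_le_Lam1 hn θmax δ
  have h2 := mul_le_mul_of_nonneg_left (Lam4_sq_le_Lam2 hn θmin δ)
    (by positivity : 0 ≤ θout ^ 2 + 2 * δ ^ 2)
  unfold phiVar
  linarith

/-- In `(M+τ)² - (m+τ)(W+τ)` the quadratic terms in `τ` cancel, so the mean grows only linearly in
`τ`, at the same rate as the standard deviation bound. -/
lemma exists_abs_phiMean_le {n : ℕ} (hn : n ≠ 0) (M m W : ℝ) :
    ∃ C, 0 ≤ C ∧ ∀ s τ : ℝ, 0 ≤ s → s ≤ 1 → 0 ≤ τ →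
      |phiMean n (M + τ) (m + τ) (W + τ) s| ≤ C * (1 + τ) := by
  set a := n * alpha n n 1 with ha
  set b := 2 * (n * alpha n n 2) with hb
  refine ⟨|M ^ 2 - m * W| + |2 * M - m - W| + (2 * |M| + |W| + 3) * |a| + |b|, by positivity,
    fun s τ hs0 hs1 hτ => ?_⟩
  have e : phiMean n (M + τ) (m + τ) (W + τ) s = (M ^ 2 - m * W) + (2 * M - m - W) * τ
      + (2 * M + W + 3 * τ) * (s * a) + s ^ 2 * b := by
    simp only [phiMean, Lam3, Lam4, alpha_one_right hn, ha, hb]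
    ring
  have hsa : |s * a| ≤ |a| := by
    rw [abs_mul, abs_of_nonneg hs0]
    exact mul_le_of_le_one_left (abs_nonneg _) hs1
  have hsb : |s ^ 2 * b| ≤ |b| := by
    rw [abs_mul, abs_of_nonneg (sq_nonneg s)]
    exact mul_le_of_le_one_left (abs_nonneg _) (pow_le_one₀ hs0 hs1)
  have h2 : |2 * M + W + 3 * τ| ≤ 2 * |M| + |W| + 3 * τ := by
    refine (abs_add_three _ _ _).trans_eq ?_
    rw [abs_mul, abs_mul, abs_of_nonneg hτ]
    norm_num
  have h3 : |(2 * M - m - W) * τ| = |2 * M - m - W| * τ := by rw [abs_mul, abs_of_nonneg hτ]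
  have h4 : |(2 * M + W + 3 * τ) * (s * a)| ≤ (2 * |M| + |W| + 3 * τ) * |a| := by
    rw [abs_mul]
    exact mul_le_mul h2 hsa (abs_nonneg _) (by positivity)
  rw [e]
  have h5 := abs_add_le ((M ^ 2 - m * W) + (2 * M - m - W) * τ
      + (2 * M + W + 3 * τ) * (s * a)) (s ^ 2 * b)
  have h6 := abs_add_three (M ^ 2 - m * W) ((2 * M - m - W) * τ)
    ((2 * M + W + 3 * τ) * (s * a))
  have h7 : 0 ≤ (|M ^ 2 - m * W| + (2 * |M| + |W|) * |a| + |b|) * τ := by positivity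
  have h8 := abs_nonneg (2 * M - m - W)
  have h9 := abs_nonneg a
  nlinarith

lemma exists_mul_sq_le_phiVar_div {n : ℕ} (hn : n ≠ 0) (M m W : ℝ) (hm : 0 < m) :
    ∃ c > 0, ∀ᶠ s in 𝓝[>] (0 : ℝ), ∀ τ p : ℝ, 0 ≤ τ → 0 < p →
      c * s ^ 2 ≤ phiVar n ((M + τ) / p) ((m + τ) / p) ((W + τ) / p) (s / p) /
        (phiVar n ((M + τ) / p) ((m + τ) / p) ((W + τ) / p) (s / p) +
          phiMean n ((M + τ) / p) ((m + τ) / p) ((W + τ) / p) (s / p) ^ 2) := by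
  obtain ⟨C, hC, hmean⟩ := exists_abs_phiMean_le hn M m W
  set a := n * alpha n n 1 with ha
  -- Once `s a < m/2`, `Λ₄ = m + τ - s a ≥ m/2 + τ ≥ κ (1 + τ)`.
  set κ := min (m / 2) 1
  have hκ : 0 < κ := by positivity
  -- From `V ≥ 2κ² s² (1+τ)²` and `E² ≤ C² (1+τ)²` the ratio is at least `2κ² s² / (2κ² s² + C²)`;
  -- then `s ≤ 1` in the denominator.
  refine ⟨2 * κ ^ 2 / (2 * κ ^ 2 + C ^ 2), by positivity, ?_⟩
  have h1 : ∀ᶠ s in 𝓝[>] (0 : ℝ), s * a < m / 2 :=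
    ((Continuous.tendsto' (by fun_prop) 0 0 (by simp)).eventually_lt_const
      (half_pos hm)).filter_mono nhdsWithin_le_nhds
  have h2 : ∀ᶠ s in 𝓝[>] (0 : ℝ), s < 1 :=
    (eventually_lt_nhds one_pos).filter_mono nhdsWithin_le_nhds
  filter_upwards [h1, h2, self_mem_nhdsWithin] with s hsa hs1 (hs0 : 0 < s) τ p hτ hp
  rw [phiMean_div _ _ _ _ _ hp.ne', phiVar_div _ _ _ _ _ hp.ne']
  have hE := hmean s τ hs0.le hs1.le hτ
  have hV := two_mul_sq_mul_Lam4_sq_le_phiVar hn (M + τ) (m + τ) (W + τ) s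
  set E := phiMean n (M + τ) (m + τ) (W + τ) s
  set Var := phiVar n (M + τ) (m + τ) (W + τ) s
  have hL : κ * (1 + τ) ≤ Lam4 n (m + τ) s := by
    have e : Lam4 n (m + τ) s = m + τ - s * a := by
      simp only [Lam4, alpha_one_right hn, ha]
      ring
    have k1 : κ ≤ m / 2 := min_le_left _ _
    have k2 : κ * τ ≤ 1 * τ := mul_le_mul_of_nonneg_right (min_le_right _ _) hτ
    rw [e]
    linarith
  have hV' : 2 * κ ^ 2 * s ^ 2 * (1 + τ) ^ 2 ≤ Var := by
    refine le_trans ?_ hV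
    have := pow_le_pow_left₀ (by positivity) hL 2
    calc 2 * κ ^ 2 * s ^ 2 * (1 + τ) ^ 2 = 2 * s ^ 2 * (κ * (1 + τ)) ^ 2 := by ring
      _ ≤ _ := by gcongr
  have hE' : E ^ 2 ≤ C ^ 2 * (1 + τ) ^ 2 := by
    rw [← mul_pow, ← sq_abs E]
    exact pow_le_pow_left₀ (abs_nonneg _) hE 2
  have hVpos : 0 < Var := lt_of_lt_of_le (by positivity) hV'
  have e : Var / p ^ 4 / (Var / p ^ 4 + (E / p ^ 2) ^ 2) = Var / (Var + E ^ 2) := by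
    rw [div_pow, ← pow_mul, ← add_div, div_div_div_cancel_right₀ (by positivity)]
  rw [e, le_div_iff₀ (by positivity), div_mul_eq_mul_div, div_mul_eq_mul_div,
    div_le_iff₀ (by positivity)]
  have hs2 : s ^ 2 ≤ 1 := pow_le_one₀ hs0.le hs1.le
  calc 2 * κ ^ 2 * s ^ 2 * (Var + E ^ 2)
      ≤ 2 * κ ^ 2 * 1 * Var + 2 * κ ^ 2 * s ^ 2 * (C ^ 2 * (1 + τ) ^ 2) := by
        rw [mul_add]
        gcongr
    _ = 2 * κ ^ 2 * Var + C ^ 2 * (2 * κ ^ 2 * s ^ 2 * (1 + τ) ^ 2) := by ring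
    _ ≤ 2 * κ ^ 2 * Var + C ^ 2 * Var := by gcongr
    _ = Var * (2 * κ ^ 2 + C ^ 2) := by ring

/-! ### Outputs of PAMST consist of edges of the graph -/

lemma subset_edgeSet_of_mem_support_pamstStep {V : Type*} [Fintype V] (G : SimpleGraph V) (μ : ℝ)
    (w : Sym2 V → ℝ) (ε : ℝ) {st st' : Finset V × Finset (Sym2 V)}
    (h : (st.2 : Set (Sym2 V)) ⊆ G.edgeSet) (h' : st' ∈ (pamstStep G μ w ε st).support) :
    (st'.2 : Set (Sym2 V)) ⊆ G.edgeSet := by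
  classical
  unfold pamstStep at h'
  split_ifs at h' with hR
  · rw [PMF.mem_support_map_iff] at h'
    obtain ⟨r, hr, rfl⟩ := h'
    have hrR : r ∈ boundaryEdges G st.1 := by
      by_contra hc
      rw [expMech, PMF.mem_support_normalize_iff] at hr
      exact hr (if_neg hc)
    simp only [boundaryEdges, Finset.mem_filter] at hrR
    simp only [Finset.coe_insert]
    exact insert_subset hrR.2.1 h
  · rw [PMF.mem_support_pure_iff] at h'
    rwa [h']

lemma subset_edgeSet_of_mem_support_pamst {V : Type*} [Fintype V] [Nonempty V]
    (G : SimpleGraph V) (μ : ℝ) (w : Sym2 V → ℝ) (ε : ℝ) {T : Finset (Sym2 V)}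
    (hT : T ∈ (pamst G μ w ε).support) : (T : Set (Sym2 V)) ⊆ G.edgeSet := by
  rw [pamst, PMF.mem_support_bind_iff] at hT
  obtain ⟨v, -, hT⟩ := hT
  rw [PMF.mem_support_map_iff] at hT
  obtain ⟨st, hst, rfl⟩ := hT
  generalize Fintype.card V - 1 = k at hst
  induction k generalizing st with
  | zero =>
    rw [Function.iterate_zero, id, PMF.mem_support_pure_iff] at hst
    simp [hst]
  | succ k ih =>
    rw [Function.iterate_succ_apply', PMF.mem_support_bind_iff] at hst
    obtain ⟨st₀, h₀, h⟩ := hst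
    exact subset_edgeSet_of_mem_support_pamstStep G μ w ε (ih st₀ h₀) h

/-! ### Homogeneous separability survives the Weight-Release mechanism -/

/-- The failure probability is at most `|E| exp(-η/s) ≤ c s²`, and `c s²` is at most the variance
ratio. The parameters `τ` and `p` stay inside the eventual statement, so the threshold on `s` does
not depend on them. -/
lemma eventually_le_weightRelease_homSep {E : Type*} [Fintype E] {w : E → ℝ} (hw : ∀ f, 0 < w f)
    {A : Finset E} {e : E} (h : HomSep w A e) {F : Finset E} (hF : F.Nonempty) {n : ℕ}
    (hn : n ≠ 0) :
    ∀ᶠ s in 𝓝[>] (0 : ℝ), ∀ τ p : ℝ, 0 ≤ τ → 0 < p →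
      1 - phiVar n ((F.sup' hF w + τ) / p) ((F.inf' hF w + τ) / p) ((w e + τ) / p) (s / p) /
        (phiVar n ((F.sup' hF w + τ) / p) ((F.inf' hF w + τ) / p) ((w e + τ) / p) (s / p) +
          phiMean n ((F.sup' hF w + τ) / p) ((F.inf' hF w + τ) / p) ((w e + τ) / p) (s / p) ^ 2) ≤
        (weightRelease w s τ p).real {w' | HomSep w' A e} := by
  obtain ⟨η, hη, hstable⟩ := h.exists_stable fun f _ => hw f
  obtain ⟨c, hc, hratio⟩ := exists_mul_sq_le_phiVar_div hn (F.sup' hF w) (F.inf' hF w) (w e)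
    ((Finset.lt_inf'_iff hF).2 fun f _ => hw f)
  filter_upwards [hratio, eventually_mul_exp_neg_div_le (Fintype.card E) hη hc (Nat.cast_nonneg _),
    self_mem_nhdsWithin] with s h1 h2 (hs : 0 < s) τ p hτ hp
  have h3 := one_sub_le_weightRelease w (τ := τ) (p := p) (S := {w' | HomSep w' A e}) hs hη
    fun Y hY => hstable Y hY τ p hτ hp
  have h4 := h1 τ p hτ hp
  linarith

end PTClust

theorem mainTheorem8 {V : Type*} [Fintype V] [Nonempty V] (G : SimpleGraph V) (hG : G.Connected)
    (w : Sym2 V → ℝ) (hw : ∀ e ∈ G.edgeSet, 0 < w e ∧ w e ≤ 1)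
    (K : ℕ) (C : Fin K → Finset V) (hC : ∀ i, PTClust.IsCluster G w (C i))
    (hdisj : ∀ i j, i ≠ j → Disjoint (C i) (C j))
    (hhom : ∀ i, PTClust.StronglyHomogeneous G w C i) :
    ∃ s₀ : ℝ, 0 < s₀ ∧
      -- the privacy parameters and the output of PAMST
      ∀ (μ ε : ℝ), 0 < μ → 0 < ε → ∀ T ∈ (PTClust.pamst G μ w ε).support,
      -- the cluster and its cut edge
      ∀ (i j : Fin K), j ≠ i → ∀ e : T, PTClust.Joins (e : Sym2 V) (C i) (C j) →
      PTClust.HomSep (PTClust.treeWeight w T) (PTClust.edgesWithin T (C i)) e →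
      -- the edge set over which the extreme weights in the laws of `Y` and `Z` are taken
      ∀ (F : Finset T) (hF : F.Nonempty), F = Finset.univ ∨ F = PTClust.edgesWithin T (C i) →
      ∀ (s τ p : ℝ), 0 < s → 0 ≤ τ → 1 ≤ p →
      ∀ (n : ℕ) (δ θmax θmin θout : ℝ), n = (C i).card - 1 → δ = s / p →
        θmax = (F.sup' hF (PTClust.treeWeight w T) + τ) / p →
        θmin = (F.inf' hF (PTClust.treeWeight w T) + τ) / p →
        θout = (PTClust.treeWeight w T e + τ) / p →
      ∀ E Var : ℝ, E = ∫ ω, PTClust.phi n ω ∂(PTClust.noiseLaw n θmax θmin θout δ) →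
        Var = variance (PTClust.phi n) (PTClust.noiseLaw n θmax θmin θout δ) →
      MemLp (PTClust.phi n) 2 (PTClust.noiseLaw n θmax θmin θout δ) ∧
      E = PTClust.Lam3 n θmax δ - θout * PTClust.Lam4 n θmin δ ∧
      Var = PTClust.Lam1 n θmax δ + (θout ^ 2 + 2 * δ ^ 2) * PTClust.Lam2 n θmin δ
        - (PTClust.Lam3 n θmax δ ^ 2 + θout ^ 2 * PTClust.Lam4 n θmin δ ^ 2) ∧
      (s ≤ s₀ →
        1 - Var / (Var + E ^ 2) ≤
          (PTClust.weightRelease (PTClust.treeWeight w T) s τ p).real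
            {w' | PTClust.HomSep w' (PTClust.edgesWithin T (C i)) e}) := by
  classical
  have hcard : ∀ i, (C i).card - 1 ≠ 0 := fun i => by
    have := (hC i).1
    omega
  have key : ∀ᶠ s in nhdsWithin (0 : ℝ) (Set.Ioi 0), ∀ (T : Finset (Sym2 V)) (i : Fin K) (e : T)
      (F : Finset T), (T : Set (Sym2 V)) ⊆ G.edgeSet →
      PTClust.HomSep (PTClust.treeWeight w T) (PTClust.edgesWithin T (C i)) e →
      ∀ (hF : F.Nonempty) (τ p : ℝ), 0 ≤ τ → 0 < p →
      1 - PTClust.phiVar ((C i).card - 1) ((F.sup' hF (PTClust.treeWeight w T) + τ) / p)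
          ((F.inf' hF (PTClust.treeWeight w T) + τ) / p)
          ((PTClust.treeWeight w T e + τ) / p) (s / p) /
        (PTClust.phiVar ((C i).card - 1) ((F.sup' hF (PTClust.treeWeight w T) + τ) / p)
          ((F.inf' hF (PTClust.treeWeight w T) + τ) / p)
          ((PTClust.treeWeight w T e + τ) / p) (s / p) +
        PTClust.phiMean ((C i).card - 1) ((F.sup' hF (PTClust.treeWeight w T) + τ) / p)
          ((F.inf' hF (PTClust.treeWeight w T) + τ) / p)
          ((PTClust.treeWeight w T e + τ) / p) (s / p) ^ 2) ≤
        (PTClust.weightRelease (PTClust.treeWeight w T) s τ p).real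
          {w' | PTClust.HomSep w' (PTClust.edgesWithin T (C i)) e} := by
    -- `T`, `i`, `e` and `F` range over finite types, so the eventual bounds can be intersected.
    refine Filter.eventually_all.2 fun T => Filter.eventually_all.2 fun i =>
      Filter.eventually_all.2 fun e => Filter.eventually_all.2 fun F => ?_
    by_cases h : (T : Set (Sym2 V)) ⊆ G.edgeSet ∧
      PTClust.HomSep (PTClust.treeWeight w T) (PTClust.edgesWithin T (C i)) e ∧ F.Nonempty
    · filter_upwards [PTClust.eventually_le_weightRelease_homSep
        (w := PTClust.treeWeight w T) (fun f => (hw f.1 (h.1 f.2)).1) h.2.1 h.2.2 (hcard i)]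
        with s hs _ _ hF
      exact hs
    · exact Filter.Eventually.of_forall fun s h1 h2 hF => absurd ⟨h1, h2, hF⟩ h
  obtain ⟨s₀, hs₀, hsub⟩ := mem_nhdsGT_iff_exists_Ioc_subset.1 key
  refine ⟨s₀, hs₀, ?_⟩
  rintro μ ε - - T hT i j - e - he F hF - s τ p hs hτ hp n δ θmax θmin θout rfl rfl rfl rfl rfl
    E Var rfl rfl
  have hp0 : 0 < p := by linarith
  obtain ⟨hL, hE, hV⟩ := PTClust.phi_moments (hcard i)
    ((F.sup' hF (PTClust.treeWeight w T) + τ) / p) ((F.inf' hF (PTClust.treeWeight w T) + τ) / p)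
    ((PTClust.treeWeight w T e + τ) / p) (div_pos hs hp0)
  refine ⟨hL, hE, hV, fun hss => ?_⟩
  rw [hE, hV]
  exact hsub ⟨hs, hss⟩ T i e F (PTClust.subset_edgeSet_of_mem_support_pamst G μ w ε hT) he hF τ p
    hτ hp0
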